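/- Let $\Lambda=\mathbb{C}[[\lambda_1,\dots,\lambda_5]]$ and let $U=1+(\lambda_1,\dots,\lambda_5)\subset\Lambda^\times$ be the multiplicative group of formal power series with constant term $1$. Let $\mathrm{Loc}$ be the algebra of local functionals in the QCD fields (components of the gluon $A$, the quark $\psi$ and its conjugate $\bar\psi$, the ghost $\omega$ and its conjugate $\bar\omega$, and the auxiliary field $h$, on 4-dimensional spacetime with gauge group $SU(3)$). That is, take the graded-commutative algebra of polynomials over $\mathbb{C}$ in all $\partial^\alpha\phi$ ($A,h$ even; $\psi,\bar\psi,\omega,\bar\omega$ odd), form the space of integrals $\int P$ of such polynomials (polynomials modulo total derivatives), and let $\mathrm{Loc}$ be the algebra generated by these integrals with graded-commutative multiplication. Put $\mathcal{F}=\mathrm{Loc}\otimes_{\mathbb{C}}\Lambda$. For $c_1,\dots,c_5,z_1,z_2,z_3\in\Lambda$, say that an algebra map $f:\mathcal{F}\to\mathcal{F}$ rescales the generators by $(c,z)$ if $f(\lambda_j)=\lambda_jc_j$ for $j=1,\dots,5$, and $f(\phi)=\phi\, z_{i}$ for each field $\phi$, where $i=1$ for $\psi,\bar\psi$, $i=2$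 for $\omega,\bar\omega$, $i=3$ for $A$, while $h$ is fixed; the latter means that $f$ commutes with partial derivatives of fields, i.e. $f\big(\int\partial^{\alpha_1}\phi_{1}\cdots\partial^{\alpha_N}\phi_{N}\big)=\big(\prod_k z_{\phi_k}\big)\int\partial^{\alpha_1}\phi_{1}\cdots\partial^{\alpha_N}\phi_{N}$, with $z_\phi$ the factor of the field $\phi$ (and $z_h=1$). Let $G'$ be the set of algebra maps that rescale the generators by some $(c,z)$ with all $c_j,z_i\in U$. Let $\mathrm{Diff}(\mathbb{C}^5,0)$ be the group, under composition, of formal maps $F=(F_1,\dots,F_5)$ with $F_i(x)=x_i\sum_{n\in\mathbb{N}^5}a^{(i)}_n x^n$ and $a^{(i)}_0=1$. Then $G'$ is a group of automorphisms of $\mathcal{F}$ under composition, and the following hold. 1. Let $H$ be any commutative Hopf algebra over $\mathbb{C}$ generated as an algebra by elements $p_n(Y_{v_j})$ ($1\le j\le5$) and $p_n(\sqrt{G^{e_i}})$ ($1\le i\le 3$), $n\in\mathbb{N}^5$, with $p_0(Y_{v_j})=p_0(\sqrt{G^{e_i}})=1$, whose coproduct is $$\Delta(Y_{v_j})=\sum_{n}Y_{v_j}Y_{v_1}^{n_1}\cdots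 Y_{v_5}^{n_5}\otimes p_n(Y_{v_j}),\qquad \Delta(\sqrt{G^{e_i}})=\sum_{n}\sqrt{G^{e_i}}\,Y_{v_1}^{n_1}\cdots Y_{v_5}^{n_5}\otimes p_n(\sqrt{G^{e_i}}),$$ read in each multidegree: with $Y_j(t)=\sum_n p_n(Y_{v_j})t^n$ and $E_i(t)=\sum_n p_n(\sqrt{G^{e_i}})t^n$ in $H[[t_1,\dots,t_5]]$, $\Delta(p_m(Y_{v_j}))=\sum_{k+n=m}[t^{k}]\big(Y_j(t)Y_1(t)^{n_1}\cdots Y_5(t)^{n_5}\big)\otimes p_n(Y_{v_j})$, and likewise for $E_i$. Then the character group $G=\mathrm{Hom}_{\mathrm{alg}}(H,\mathbb{C})$, with the convolution product, is a subgroup of $G'$: there is an injective group homomorphism $G\to G'$ sending $\chi$ to an automorphism that rescales the generators by $c_j=\sum_n\chi(p_n(Y_{v_j}))\lambda^n$ and $z_i=\sum_n\chi(p_n(\sqrt{G^{e_i}}))\lambda^n$. 2. The subgroup $N=\{f\in G': f(\lambda_j)=\lambda_j,\ j=1,\dots,5\}$ is normal in $G'$ and isomorphic to $U^3$, by an isomorphism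 under which the element $f$ corresponding to $z\in U^3$ rescales the generators by $(1,z)$. 3. $G'\cong U^3\rtimes\mathrm{Diff}(\mathbb{C}^5,0)$, where $F\in \mathrm{Diff}(\mathbb{C}^5,0)$ acts on $U^3$ by $z_i\mapsto z_i\circ F^{-1}$; there is an isomorphism under which the element $f$ corresponding to $(z,F)$ satisfies $f(\lambda_j)=(F^{-1})_j(\lambda)$ and rescales the fields by $z$. -/

import Mathlib

open scoped TensorProduct

noncomputable section

namespace QCD

/-! ### Local functionals in the QCD fields -/

/-- The QCD fields: gluon `A`, quark `psi` and its conjugate, ghost `omega` and antighost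
`omegabar`, and the auxiliary (Nakanishi--Lautrup) field `h`. -/
inductive FieldType
  | A | psi | psibar | omega | omegabar | h

/-- The index set of the components of each field on four-dimensional spacetime, with gauge
group `SU(3)`: `A` has components `A_μ^a`, quarks have spinor and colour indices, and
`omega`, `omegabar`, `h` take values in the eight-dimensional Lie algebra `su(3)`. -/
def Component : FieldType → Type
  | .A => Fin 4 × Fin 8
  | .psi => Fin 4 × Fin 3
  | .psibar => Fin 4 × Fin 3
  | .omega => Fin 8
  | .omegabar => Fin 8
  | .h => Fin 8

/-- The Grassmann degree of a field. -/
def grassmannDegree : FieldType → ℤ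
  | .A => 0
  | .psi => 1
  | .psibar => -1
  | .omega => 1
  | .omegabar => -1
  | .h => 0

/-- The jet variable `∂^α φ^a`: a component of a field together with a multi-index of
spacetime derivatives. -/
structure JetVar where
  field : FieldType
  comp : Component field
  deriv : Fin 4 →₀ ℕ

/-- The Grassmann degree of a monomial in the jet variables. -/
def wordDegree (w : List JetVar) : ℤ := (w.map fun x => grassmannDegree x.field).sum

/-- The Koszul sign `(-1)^(p q)`. -/
def koszul (p q : ℤ) : ℂ := (-1 : ℂ) ^ (p * q)

/-- Graded commutativity of the jet variables. -/
inductive JetRel : FreeAlgebra ℂ JetVar → FreeAlgebra ℂ JetVar → Prop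
  | swap (x y : JetVar) :
      JetRel (FreeAlgebra.ι ℂ x * FreeAlgebra.ι ℂ y)
        (koszul (grassmannDegree x.field) (grassmannDegree y.field) •
          (FreeAlgebra.ι ℂ y * FreeAlgebra.ι ℂ x))

/-- The graded-commutative algebra of polynomials in the fields and their derivatives. -/
abbrev FieldPoly : Type := RingQuot JetRel

/-- A jet variable as a polynomial. -/
def jet (x : JetVar) : FieldPoly := RingQuot.mkAlgHom ℂ JetRel (FreeAlgebra.ι ℂ x)

/-- The monomial `∂^{α₁} φ_{i₁} ⋯ ∂^{α_N} φ_{i_N}`. -/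
def monomial (w : List JetVar) : FieldPoly := (w.map jet).prod

/-- The partial derivative `∂_μ` of a jet variable. -/
def JetVar.partial (μ : Fin 4) (x : JetVar) : JetVar :=
  { x with deriv := x.deriv + Finsupp.single μ 1 }

/-- The partial derivative `∂_μ` of a monomial, by the Leibniz rule. -/
def partialMonomial (μ : Fin 4) (w : List JetVar) : FieldPoly :=
  ∑ k ∈ Finset.range w.length, monomial (w.modify k (JetVar.partial μ))

/-- The total derivatives: the linear span of all `∂_μ P` for polynomials `P`. -/
def totalDerivatives : Submodule ℂ FieldPoly :=
  Submodule.span ℂ (Set.range fun p : Fin 4 × List JetVar => partialMonomial p.1 p.2)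

/-- The integrals `∫ P` of polynomials `P` in the fields and their derivatives: the integral
of a total derivative vanishes. -/
abbrev Integrals : Type := FieldPoly ⧸ totalDerivatives

/-- The integral `∫ ∂^{α₁} φ_{i₁} ⋯ ∂^{α_N} φ_{i_N}` of a monomial. -/
def integral (w : List JetVar) : Integrals := totalDerivatives.mkQ (monomial w)

/-- Graded commutativity of the multiplication of integrals. -/
inductive LocRel : TensorAlgebra ℂ Integrals → TensorAlgebra ℂ Integrals → Prop
  | swap (v w : List JetVar) :
      LocRel (TensorAlgebra.ι ℂ (integral v) * TensorAlgebra.ι ℂ (integral w))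
        (koszul (wordDegree v) (wordDegree w) •
          (TensorAlgebra.ι ℂ (integral w) * TensorAlgebra.ι ℂ (integral v)))

/-- The algebra of local functionals: integrals of polynomials in the fields and their
derivatives, with multiplication of integrals as algebra structure. -/
abbrev Loc : Type := RingQuot LocRel

/-- The integral of a monomial as an element of `Loc`. -/
def locIntegral (w : List JetVar) : Loc :=
  RingQuot.mkAlgHom ℂ LocRel (TensorAlgebra.ι ℂ (integral w))

/-! ### The algebra `F` and its rescaling maps -/

/-- Formal power series `ℂ[[λ₁, …, λ₅]]` in the coupling constants. -/
abbrev Couplings : Type := MvPowerSeries (Fin 5) ℂ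

/-- `F = Loc ⊗ ℂ[[λ₁, …, λ₅]]`. -/
abbrev F : Type := Loc ⊗[ℂ] Couplings

/-- A power series in the couplings as an element of `F`. -/
def ofSeries (a : Couplings) : F := (1 : Loc) ⊗ₜ[ℂ] a

/-- The coupling constant `λ_j` as an element of `F`. -/
def coupling (j : Fin 5) : F := ofSeries (MvPowerSeries.X j)

/-- The rescaling factor of each field when the quark, ghost and gluon fields are rescaled by
`z 0`, `z 1`, `z 2` (the order of the edges `e₁, e₂, e₃`). Conjugate fields are rescaled
as the fields themselves, and the auxiliary field, which has no edge, is fixed. -/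
def factor (z : Fin 3 → Couplings) : FieldType → Couplings
  | .psi => z 0
  | .psibar => z 0
  | .omega => z 1
  | .omegabar => z 1
  | .A => z 2
  | .h => 1

/-- The algebra map `f` rescales the generators, `λ_j ↦ λ_j c_j` and `φ_i ↦ φ_i z_i`, and
commutes with the partial derivatives of the fields, so that an integral of a monomial is
multiplied by the product of the factors of the fields in it. -/
structure RescalesBy (f : F →ₐ[ℂ] F) (c : Fin 5 → Couplings) (z : Fin 3 → Couplings) :
    Prop where
  coupling : ∀ j, f (coupling j) = ofSeries (MvPowerSeries.X j * c j)
  integral : ∀ w : List JetVar, f (locIntegral w ⊗ₜ[ℂ] (1 : Couplings)) =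
    locIntegral w ⊗ₜ[ℂ] (w.map fun x => factor z x.field).prod

/-- `f` rescales the generators by some power series with constant term `1`. -/
def IsRescaling (f : F →ₐ[ℂ] F) : Prop :=
  ∃ (c : Fin 5 → Couplings) (z : Fin 3 → Couplings),
    (∀ j, MvPowerSeries.constantCoeff (c j) = 1) ∧
    (∀ i, MvPowerSeries.constantCoeff (z i) = 1) ∧ RescalesBy f c z

/-- The multiplicative group of power series with constant term `1`. -/
def OneUnits : Subgroup Couplingsˣ :=
  (Units.map (MvPowerSeries.constantCoeff (σ := Fin 5) (R := ℂ)).toMonoidHom).ker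

/-! ### The group of formal diffeomorphisms -/

/-- An element of `Diff(ℂ⁵, 0)`: the formal map `f = (f₁, …, f₅)` with
`f_i(x) = x_i (∑ a_n x^n)`, where `a_0 = 1`; the field `coef i` is the series `∑ a_n x^n`. -/
@[ext]
structure Diff where
  coef : Fin 5 → Couplings
  constantCoeff_coef : ∀ i, MvPowerSeries.constantCoeff (coef i) = 1

namespace Diff

/-- The components `f_i(x) = x_i (∑ a_n x^n)`. -/
def map (f : Diff) (i : Fin 5) : Couplings := MvPowerSeries.X i * f.coef i

theorem hasSubst (f : Diff) : MvPowerSeries.HasSubst f.map :=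
  MvPowerSeries.hasSubst_of_constantCoeff_zero fun i => by simp [map]

/-- Composition `a ∘ f` of a power series `a` with a formal diffeomorphism `f`. -/
def pull (f : Diff) (a : Couplings) : Couplings := MvPowerSeries.subst f.map a

theorem map_injective {f g : Diff} (h : f.map = g.map) : f = g := by
  ext1
  funext i
  have hi := congrFun h i
  simp only [map] at hi
  ext n
  have := congrArg (MvPowerSeries.coeff (Finsupp.single i 1 + n)) hi
  simpa [MvPowerSeries.X, MvPowerSeries.coeff_add_monomial_mul] using this

theorem pull_mul (f : Diff) (a b : Couplings) : f.pull (a * b) = f.pull a * f.pull b :=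
  MvPowerSeries.subst_mul f.hasSubst a b

theorem pull_X (f : Diff) (i : Fin 5) : f.pull (MvPowerSeries.X i) = f.map i :=
  MvPowerSeries.subst_X f.hasSubst i

theorem prod_map (f : Diff) (d : Fin 5 →₀ ℕ) :
    (d.prod fun s e => f.map s ^ e) =
      MvPowerSeries.monomial d (1 : ℂ) * ∏ i, f.coef i ^ d i := by
  rw [Finsupp.prod_fintype _ _ (by simp)]
  simp only [map, mul_pow, Finset.prod_mul_distrib]
  congr 1
  have : MvPowerSeries.monomial d (1 : ℂ) =
      ((MvPolynomial.monomial d (1 : ℂ) : MvPolynomial (Fin 5) ℂ) : Couplings) := by simp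
  rw [this, MvPolynomial.monomial_eq, Finsupp.prod_fintype _ _ (by simp)]
  simp only [map_one, one_mul]
  rw [← MvPolynomial.coeToMvPowerSeries.ringHom_apply, map_prod]
  simp

theorem coeff_pull {f : Diff} {a : Couplings} {k : ℕ}
    (ha : ∀ m : Fin 5 →₀ ℕ, m.degree < k → MvPowerSeries.coeff m a = 0)
    {n : Fin 5 →₀ ℕ} (hn : n.degree ≤ k) :
    MvPowerSeries.coeff n (f.pull a) = MvPowerSeries.coeff n a := by
  classical
  rw [pull, MvPowerSeries.coeff_subst f.hasSubst, finsum_eq_single _ n]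
  · rw [prod_map, MvPowerSeries.coeff_monomial_mul]
    simp [f.constantCoeff_coef]
  · intro d hd
    rw [prod_map, MvPowerSeries.coeff_monomial_mul]
    by_cases hk : d.degree < k
    · simp [ha d hk]
    · rw [if_neg, smul_zero]
      intro hle
      apply hd
      obtain ⟨e, rfl⟩ := exists_add_of_le hle
      have he : e.degree = 0 := by
        rw [map_add] at hn
        omega
      rw [Finsupp.degree_eq_zero_iff] at he
      simp [he]

theorem constantCoeff_pull (f : Diff) (a : Couplings) :
    MvPowerSeries.constantCoeff (f.pull a) = MvPowerSeries.constantCoeff a := by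
  have := coeff_pull (f := f) (a := a) (k := 0) (n := 0) (by simp) (by simp)
  simpa using this

/-- The successive approximations to the solution `d` of `d ∘ f = b`. -/
def approx (f : Diff) (b : Couplings) : ℕ → Couplings
  | 0 => 0
  | k + 1 => approx f b k + (b - f.pull (approx f b k))

theorem pull_add (f : Diff) (a b : Couplings) : f.pull (a + b) = f.pull a + f.pull b :=
  MvPowerSeries.subst_add f.hasSubst a b

theorem pull_sub (f : Diff) (a b : Couplings) : f.pull (a - b) = f.pull a - f.pull b :=
  MvPowerSeries.subst_sub f.hasSubst a b

theorem approx_spec (f : Diff) (b : Couplings) (k : ℕ) :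
    ∀ m : Fin 5 →₀ ℕ, m.degree < k →
      MvPowerSeries.coeff m (b - f.pull (approx f b k)) = 0 := by
  induction k with
  | zero => simp
  | succ k ih =>
    intro m hm
    have h := coeff_pull (f := f) ih (n := m) (by omega)
    have e : b - f.pull (approx f b (k + 1)) =
        (b - f.pull (approx f b k)) - f.pull (b - f.pull (approx f b k)) := by
      rw [approx, pull_add]
      ring
    rw [e, map_sub, h, sub_self]

theorem coeff_approx (f : Diff) (b : Couplings) (k : ℕ) (m : Fin 5 →₀ ℕ)
    (hm : m.degree < k) :
    MvPowerSeries.coeff m (approx f b k) =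
      MvPowerSeries.coeff m (approx f b (m.degree + 1)) := by
  induction k with
  | zero => omega
  | succ k ih =>
    rcases Nat.lt_succ_iff_lt_or_eq.mp hm with h | h
    · rw [approx, map_add, approx_spec f b k m h, add_zero, ih h]
    · rw [h]

theorem pull_surjective (f : Diff) (b : Couplings) : ∃ d, f.pull d = b := by
  let d : Couplings := fun m => MvPowerSeries.coeff m (approx f b (m.degree + 1))
  refine ⟨d, ?_⟩
  ext n
  have h1 : ∀ m : Fin 5 →₀ ℕ, m.degree < n.degree + 1 →
      MvPowerSeries.coeff m (d - approx f b (n.degree + 1)) = 0 := by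
    intro m hm
    rw [map_sub, coeff_approx f b _ m hm]
    exact sub_self _
  have h2 := coeff_pull (f := f) h1 (n := n) (by omega)
  rw [h1 n (by omega), pull_sub, map_sub, sub_eq_zero] at h2
  have h3 := approx_spec f b (n.degree + 1) n (by omega)
  rw [map_sub, sub_eq_zero] at h3
  rw [h2, h3]

/-- Composition: `(f * g)(x) = f(g(x))`. -/
instance : Mul Diff :=
  ⟨fun f g => ⟨fun i => g.coef i * g.pull (f.coef i), fun i => by
    rw [map_mul, constantCoeff_pull, f.constantCoeff_coef, g.constantCoeff_coef, one_mul]⟩⟩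

/-- The identity map. -/
instance : One Diff := ⟨⟨fun _ => 1, fun _ => by simp⟩⟩

theorem map_mul_eq (f g : Diff) (i : Fin 5) : (f * g).map i = g.pull (f.map i) := by
  rw [map, map, pull_mul, pull_X, map, mul_assoc]
  rfl

theorem map_one_eq (i : Fin 5) : (1 : Diff).map i = MvPowerSeries.X i := mul_one _

theorem pull_one (a : Couplings) : (1 : Diff).pull a = a := by
  have : (1 : Diff).map = MvPowerSeries.X := funext map_one_eq
  rw [pull, this, MvPowerSeries.subst_self]
  rfl

theorem pull_pull (f g : Diff) (a : Couplings) : g.pull (f.pull a) = (f * g).pull a := by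
  have : (f * g).map = fun i => MvPowerSeries.subst g.map (f.map i) := funext (map_mul_eq f g)
  rw [pull, pull, pull, this, MvPowerSeries.subst_comp_subst_apply f.hasSubst g.hasSubst]

theorem exists_inv (f : Diff) : ∃ g : Diff, g * f = 1 := by
  have hb : ∀ i, ∃ b : Couplings, f.coef i * b = 1 := fun i =>
    ⟨(f.coef i)⁻¹, MvPowerSeries.mul_inv_cancel _ (by simp [f.constantCoeff_coef])⟩
  choose b hb using hb
  choose d hd using fun i => f.pull_surjective (b i)
  have hd1 : ∀ i, MvPowerSeries.constantCoeff (d i) = 1 := fun i => by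
    have := congrArg MvPowerSeries.constantCoeff (hb i)
    rwa [map_mul, f.constantCoeff_coef, one_mul, map_one, ← hd i, constantCoeff_pull] at this
  refine ⟨⟨d, hd1⟩, ?_⟩
  ext1
  funext i
  change f.coef i * f.pull (d i) = 1
  rw [hd, hb]

instance : Inv Diff := ⟨fun f => f.exists_inv.choose⟩

/-- The group of formal diffeomorphisms under composition. -/
instance : Group Diff :=
  Group.ofLeftAxioms
    (fun f g h => map_injective (funext fun i => by
      rw [map_mul_eq, map_mul_eq, map_mul_eq, pull_pull]))
    (fun f => map_injective (funext fun i => by rw [map_mul_eq, map_one_eq, pull_X]))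
    (fun f => f.exists_inv.choose_spec)

end Diff

/-! ### Hopf algebras generated by Green's functions -/

/-- The formal series `∑ a_n t^n` with coefficients in an algebra, where `t` keeps track of
the multidegree. -/
def genSeries {H : Type*} (a : (Fin 5 →₀ ℕ) → H) : MvPowerSeries (Fin 5) H := a

/-- The commutative Hopf algebra `H` is generated by elements `Y j n = p_n(Y_{v_j})` and
`E i n = p_n(√G^{e_i})`, each series having leading term `1`, with the coproduct
`Δ(Y_{v_j}) = ∑ Y_{v_j} Y_{v_1}^{n_1} ⋯ Y_{v_5}^{n_5} ⊗ p_n(Y_{v_j})` and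
`Δ(√G^{e_i}) = ∑ √G^{e_i} Y_{v_1}^{n_1} ⋯ Y_{v_5}^{n_5} ⊗ p_n(√G^{e_i})`, here written out
in each multidegree `m`. -/
structure IsGreenHopfAlgebra (H : Type*) [CommRing H] [HopfAlgebra ℂ H]
    (Y : Fin 5 → (Fin 5 →₀ ℕ) → H) (E : Fin 3 → (Fin 5 →₀ ℕ) → H) : Prop where
  Y_zero : ∀ j, Y j 0 = 1
  E_zero : ∀ i, E i 0 = 1
  adjoin_eq_top : Algebra.adjoin ℂ
    (Set.range (fun p : Fin 5 × (Fin 5 →₀ ℕ) => Y p.1 p.2) ∪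
      Set.range (fun p : Fin 3 × (Fin 5 →₀ ℕ) => E p.1 p.2)) = ⊤
  comul_Y : ∀ j m, Coalgebra.comul (R := ℂ) (Y j m) =
    ∑ p ∈ Finset.HasAntidiagonal.antidiagonal m,
      MvPowerSeries.coeff p.1 (genSeries (Y j) * ∏ k, genSeries (Y k) ^ p.2 k) ⊗ₜ[ℂ] Y j p.2
  comul_E : ∀ i m, Coalgebra.comul (R := ℂ) (E i m) =
    ∑ p ∈ Finset.HasAntidiagonal.antidiagonal m,
      MvPowerSeries.coeff p.1 (genSeries (E i) * ∏ k, genSeries (Y k) ^ p.2 k) ⊗ₜ[ℂ] E i p.2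

/-- The group of characters of a Hopf algebra under the convolution product. -/
abbrev CharacterGroup (H : Type*) [CommRing H] [HopfAlgebra ℂ H] : Type _ :=
  WithConv (H →ₐ[ℂ] ℂ)

/-- The power series `∑ χ(a_n) λ^n`. -/
def charSeries {H : Type*} [CommRing H] [HopfAlgebra ℂ H] (χ : CharacterGroup H)
    (a : (Fin 5 →₀ ℕ) → H) : Couplings :=
  fun n => χ.ofConv (a n)

end QCD

end

noncomputable section

namespace QCD

/-! ### Power series in the couplings inside `F` -/

/-! A rescaling amounts to a pair `(D, z)`, where `D` is the formal diffeomorphism with coefficients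
`c` and `z` lies in `U³`. Each pair gives a map `rescale D z`: on `Loc` the fields are multiplied by
their factors, which respects the Koszul relations and total derivatives, and on power series the
map is the substitution of `D`.

Pairs and maps determine each other. A map is determined by its factors (`RescalesBy.algHom_ext`)
because monomial integrals generate `Loc` and because, even without continuity, an algebra map on
power series sending each variable into `X j * Λ` is fixed by its values on the variables
(`series_algHom_ext`). The factors are determined by the map (`RescalesBy.unique`) because integrals
of single undifferentiated fields are nonzero in `Loc`.

Composition gives `(D, z) ∘ (D', z') = (D' * D, z · (z' ∘ D))` (`rescale_comp`). The order of the
diffeomorphisms is reversed, so after passing to `D⁻¹` this is the product of `U³ ⋊ Diff`. Hence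
`G'` is the range of an injective homomorphism `rescaleAut` from that group, and `N` is the kernel
of the projection to `Diff`. For a Green's function Hopf algebra, the coproduct is dual to `b · (a ∘
D)` (`Diff.coeff_mul_pull`), so convolution of characters becomes composition of rescalings. -/

theorem exists_eq_C_add_sum_X_mul {σ R : Type*} [Fintype σ] [CommSemiring R]
    (a : MvPowerSeries σ R) : ∃ b : σ → MvPowerSeries σ R,
      a = MvPowerSeries.C (MvPowerSeries.constantCoeff a) + ∑ j, MvPowerSeries.X j * b j := by
  classical
  have hs : ∀ m : σ →₀ ℕ, m ≠ 0 → ∃ j, m j ≠ 0 := fun m hm => by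
    by_contra! h
    exact hm (Finsupp.ext h)
  rcases isEmpty_or_nonempty σ with h | h
  · refine ⟨0, ?_⟩
    ext m
    simp [Subsingleton.elim m 0]
  choose! s hs using hs
  -- Each nonconstant exponent is assigned to one variable `s m` occurring in it, so that its
  -- coefficient is counted exactly once.
  let b : σ → MvPowerSeries σ R := fun j n => if s (n + Finsupp.single j 1) = j then
    MvPowerSeries.coeff (n + Finsupp.single j 1) a else 0
  refine ⟨b, ?_⟩
  ext m
  have key : ∀ j, MvPowerSeries.coeff m (MvPowerSeries.X j * b j) =
      if m j ≠ 0 ∧ s m = j then MvPowerSeries.coeff m a else 0 := by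
    intro j
    rw [MvPowerSeries.X_def, MvPowerSeries.coeff_monomial_mul, one_mul]
    by_cases hj : m j = 0
    · simp [hj]
    · have hle : Finsupp.single j 1 ≤ m := by
        rw [Finsupp.single_le_iff]
        omega
      rw [if_pos hle]
      change (if s (m - Finsupp.single j 1 + Finsupp.single j 1) = j then
        MvPowerSeries.coeff (m - Finsupp.single j 1 + Finsupp.single j 1) a else 0) = _
      rw [tsub_add_cancel_of_le hle]
      simp [hj]
  rw [map_add, map_sum, Finset.sum_congr rfl fun j _ => key j, MvPowerSeries.coeff_C]
  by_cases hm : m = 0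
  · simp [hm]
  · rw [if_neg hm, zero_add, Finset.sum_eq_single (s m)]
    · simp [hs m hm]
    · intro j _ hj
      rw [if_neg fun h => hj h.2.symm]
    · simp

/-- The contraction of `F` with a linear functional on `Loc`. -/
def contract (l : Loc →ₗ[ℂ] ℂ) : F →ₗ[ℂ] Couplings :=
  (TensorProduct.lid ℂ Couplings).toLinearMap ∘ₗ l.rTensor Couplings

theorem contract_tmul (l : Loc →ₗ[ℂ] ℂ) (x : Loc) (a : Couplings) :
    contract l (x ⊗ₜ a) = l x • a := by
  simp [contract]

theorem contract_ofSeries_mul (l : Loc →ₗ[ℂ] ℂ) (a : Couplings) (x : F) :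
    contract l (ofSeries a * x) = a * contract l x := by
  induction x using TensorProduct.induction_on with
  | zero => simp
  | add x y hx hy => rw [mul_add, map_add, map_add, hx, hy, mul_add]
  | tmul x b =>
    rw [ofSeries, Algebra.TensorProduct.tmul_mul_tmul, one_mul, contract_tmul, contract_tmul,
      mul_smul_comm]

/-- A basis of `Loc` identifies `F` with finitely supported families of power series, whose entries
are the contractions with the coordinate functionals. -/
theorem ext_of_contract_eq {x y : F} (h : ∀ l, contract l x = contract l y) : x = y := by
  classical
  let b := Module.Basis.ofVectorSpace ℂ Loc
  have key : ∀ (x : F) i, TensorProduct.equivFinsuppOfBasisLeft (N := Couplings) b x i =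
      contract (b.coord i) x := by
    intro x i
    induction x using TensorProduct.induction_on with
    | zero => simp
    | add x y hx hy => rw [map_add, map_add, Finsupp.add_apply, hx, hy]
    | tmul x a => simp [contract_tmul]
  apply (TensorProduct.equivFinsuppOfBasisLeft (N := Couplings) b).injective
  ext1 i
  rw [key, key, h]

/-- Algebra maps from power series to `F` that rescale the variables are determined by their
values on the variables. -/
theorem series_algHom_ext {f g : Couplings →ₐ[ℂ] F} (c : Fin 5 → Couplings)
    (hf : ∀ j, f (MvPowerSeries.X j) = ofSeries (MvPowerSeries.X j * c j))
    (hg : ∀ j, g (MvPowerSeries.X j) = ofSeries (MvPowerSeries.X j * c j)) : f = g := by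
  -- Induction on degree replaces continuity: writing `a` as a constant plus `∑ X j * b j`, the
  -- image of `X j` carries a factor `X j`, so only coefficients of lower degree of the image of `b
  -- j` enter.
  have key : ∀ (l : Loc →ₗ[ℂ] ℂ) (k : ℕ) (a : Couplings) (m : Fin 5 →₀ ℕ), m.degree < k →
      MvPowerSeries.coeff m (contract l (f a)) = MvPowerSeries.coeff m (contract l (g a)) := by
    intro l k
    induction k with
    | zero => simp
    | succ k ih =>
      intro a m hm
      obtain ⟨b, hb⟩ := exists_eq_C_add_sum_X_mul a
      have hC : ∀ (r : ℂ) (f : Couplings →ₐ[ℂ] F), f (MvPowerSeries.C r) = algebraMap ℂ F r :=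
        fun r f => f.commutes r
      rw [hb]
      simp only [map_add, map_sum, map_mul, hC, hf, hg]
      congr 1
      refine Finset.sum_congr rfl fun j _ => ?_
      classical
      rw [contract_ofSeries_mul, contract_ofSeries_mul, mul_assoc, mul_assoc,
        MvPowerSeries.X_def, MvPowerSeries.coeff_monomial_mul,
        MvPowerSeries.coeff_monomial_mul, one_mul, one_mul]
      split_ifs with hle
      · rw [MvPowerSeries.coeff_mul, MvPowerSeries.coeff_mul]
        refine Finset.sum_congr rfl fun p hp => ?_
        rw [ih _ _ ?_]
        have h1 := congrArg Finsupp.degree (Finset.HasAntidiagonal.mem_antidiagonal.mp hp)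
        have h2 := congrArg Finsupp.degree (tsub_add_cancel_of_le hle)
        simp only [map_add, Finsupp.degree_single] at h1 h2
        omega
      · rfl
  ext a
  refine ext_of_contract_eq fun l => ?_
  ext m
  exact key l _ a m (Nat.lt_succ_self _)

/-! ### Nonvanishing of the integrals of single fields -/

/-- The evaluation of polynomials of degree at most one: the constant term and the coefficient
of the jet variable `x`. -/
def linearPart (x : JetVar) : FieldPoly →ₐ[ℂ] DualNumber ℂ :=
  open scoped Classical in
  RingQuot.liftAlgHom ℂ ⟨FreeAlgebra.lift ℂ fun y => if y = x then DualNumber.eps else 0, by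
    rintro _ _ ⟨y, y'⟩
    simp only [map_mul, map_smul, FreeAlgebra.lift_ι_apply]
    -- Both sides of the relation vanish since `eps * eps = 0`, whatever the Koszul sign.
    split_ifs <;> simp⟩

theorem linearPart_jet (x y : JetVar) [Decidable (y = x)] :
    linearPart x (jet y) = if y = x then DualNumber.eps else 0 := by
  rw [linearPart, jet, RingQuot.liftAlgHom_mkAlgHom_apply, FreeAlgebra.lift_ι_apply]
  congr

/-- Differentiating a single jet variable gives a nonzero multi-index, hence never `x`; words of
length at least two contain a product of two multiples of `eps`. -/
theorem linearPart_partialMonomial (x : JetVar) (hx : x.deriv = 0) (μ : Fin 4)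
    (w : List JetVar) : linearPart x (partialMonomial μ w) = 0 := by
  classical
  have h2 : ∀ y y', linearPart x (jet y) * linearPart x (jet y') = 0 := fun y y' => by
    rw [linearPart_jet, linearPart_jet]
    split_ifs <;> simp
  match w with
  | [] => simp [partialMonomial]
  | [y] =>
    have : y.partial μ ≠ x := by
      rintro rfl
      have := DFunLike.congr_fun hx μ
      simp [JetVar.partial] at this
    simp [partialMonomial, monomial, linearPart_jet, this]
  | y :: y' :: w =>
    rw [partialMonomial, map_sum]
    refine Finset.sum_eq_zero fun k _ => ?_
    obtain ⟨v, v', u, hu⟩ : ∃ v v' u, (y :: y' :: w).modify k (JetVar.partial μ) =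
        v :: v' :: u := by
      match k with
      | 0 => exact ⟨_, _, _, rfl⟩
      | 1 => exact ⟨_, _, _, rfl⟩
      | k + 2 => exact ⟨_, _, _, rfl⟩
    rw [hu]
    simp only [monomial, List.map_cons, List.prod_cons, map_mul]
    rw [← mul_assoc, h2, zero_mul]

/-- The coefficient of `∫ x` in an integral. -/
def integralCoeff (x : JetVar) (hx : x.deriv = 0) : Integrals →ₗ[ℂ] ℂ :=
  totalDerivatives.liftQ ((TrivSqZeroExt.sndHom ℂ ℂ) ∘ₗ (linearPart x).toLinearMap) (by
    rw [totalDerivatives, Submodule.span_le]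
    rintro _ ⟨p, rfl⟩
    simp [linearPart_partialMonomial x hx])

theorem integralCoeff_self (x : JetVar) (hx : x.deriv = 0) :
    integralCoeff x hx (integral [x]) = 1 := by
  classical
  rw [integral, integralCoeff, Submodule.mkQ_apply, Submodule.liftQ_apply]
  simp [monomial, linearPart_jet]

/-- The part of degree at most one of a local functional. -/
def locLinearPart (x : JetVar) (hx : x.deriv = 0) : Loc →ₐ[ℂ] DualNumber ℂ :=
  RingQuot.liftAlgHom ℂ ⟨TensorAlgebra.lift ℂ
    (TrivSqZeroExt.inrHom ℂ ℂ ∘ₗ integralCoeff x hx), by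
    rintro _ _ ⟨v, w⟩
    simp⟩

/-- Guarantees that `∫ x` does not vanish in `Loc`, so that the factor of a field can be read off
from a rescaling map. -/
theorem exists_functional_integral (x : JetVar) (hx : x.deriv = 0) :
    ∃ l : Loc →ₗ[ℂ] ℂ, l (locIntegral [x]) = 1 := by
  refine ⟨TrivSqZeroExt.sndHom ℂ ℂ ∘ₗ (locLinearPart x hx).toLinearMap, ?_⟩
  simp [locLinearPart, locIntegral, RingQuot.liftAlgHom_mkAlgHom_apply, integralCoeff_self]

theorem exists_functional_one : ∃ l : Loc →ₗ[ℂ] ℂ, l 1 = 1 := by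
  refine ⟨(TrivSqZeroExt.fstHom ℂ ℂ ℂ).toLinearMap ∘ₗ
    (locLinearPart ⟨.h, (0 : Fin 8), 0⟩ rfl).toLinearMap, ?_⟩
  simp

theorem tmul_injective {x : Loc} (hx : ∃ l : Loc →ₗ[ℂ] ℂ, l x = 1) :
    Function.Injective fun a : Couplings => (x ⊗ₜ[ℂ] a : F) := by
  obtain ⟨l, hl⟩ := hx
  intro a b h
  simpa [contract_tmul, hl] using congrArg (contract l) h

theorem ofSeries_injective : Function.Injective ofSeries :=
  tmul_injective exists_functional_one

/-! ### Construction of the rescaling maps -/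

/-- The product of the factors of the fields in a monomial. -/
def wordFactor (z : Fin 3 → Couplings) (w : List JetVar) : Couplings :=
  (w.map fun x => factor z x.field).prod

/-- The rescaling of the fields on polynomials. -/
def polyRescale (z : Fin 3 → Couplings) : FieldPoly →ₐ[ℂ] FieldPoly ⊗[ℂ] Couplings :=
  RingQuot.liftAlgHom ℂ ⟨FreeAlgebra.lift ℂ fun x => jet x ⊗ₜ factor z x.field, by
    rintro _ _ ⟨x, y⟩
    have h : jet x * jet y =
        koszul (grassmannDegree x.field) (grassmannDegree y.field) • (jet y * jet x) := by
      simpa only [jet, map_mul, map_smul] using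
        RingQuot.mkAlgHom_rel ℂ (JetRel.swap x y)
    -- The factors are ordinary commuting series, so they produce no sign beyond that of the fields.
    simp only [map_mul, map_smul, FreeAlgebra.lift_ι_apply,
      Algebra.TensorProduct.tmul_mul_tmul, h, TensorProduct.smul_tmul',
      mul_comm (factor z x.field)]⟩

theorem polyRescale_monomial (z : Fin 3 → Couplings) (w : List JetVar) :
    polyRescale z (monomial w) = monomial w ⊗ₜ wordFactor z w := by
  induction w with
  | nil => simp [monomial, wordFactor, Algebra.TensorProduct.one_def]
  | cons x w ih =>
    have hx : polyRescale z (jet x) = jet x ⊗ₜ factor z x.field := by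
      rw [polyRescale, jet, RingQuot.liftAlgHom_mkAlgHom_apply, FreeAlgebra.lift_ι_apply, jet]
    simp only [monomial, wordFactor, List.map_cons, List.prod_cons, map_mul] at ih ⊢
    rw [ih, hx, Algebra.TensorProduct.tmul_mul_tmul]

/-- The factor depends only on the field, not on its derivatives; this is why rescaling descends
modulo total derivatives. -/
theorem wordFactor_modify (z : Fin 3 → Couplings) (μ : Fin 4) (w : List JetVar) (k : ℕ) :
    wordFactor z (w.modify k (JetVar.partial μ)) = wordFactor z w := by
  induction w generalizing k with
  | nil => simp
  | cons x w ih =>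
    cases k with
    | zero => rfl
    | succ k =>
      have := ih k
      simp only [wordFactor] at this
      simp only [wordFactor, List.modify_succ_cons, List.map_cons, List.prod_cons, this]

theorem polyRescale_partialMonomial (z : Fin 3 → Couplings) (μ : Fin 4) (w : List JetVar) :
    polyRescale z (partialMonomial μ w) = partialMonomial μ w ⊗ₜ wordFactor z w := by
  simp only [partialMonomial, map_sum, polyRescale_monomial, wordFactor_modify,
    TensorProduct.sum_tmul]

theorem totalDerivatives_le_ker_rescale (z : Fin 3 → Couplings) : totalDerivatives ≤
    (totalDerivatives.mkQ.rTensor Couplings ∘ₗ (polyRescale z).toLinearMap).ker := by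
  refine Submodule.span_le.mpr ?_
  rintro _ ⟨p, rfl⟩
  have : totalDerivatives.mkQ (partialMonomial p.1 p.2) = 0 :=
    (Submodule.Quotient.mk_eq_zero _).mpr (Submodule.subset_span ⟨p, rfl⟩)
  rw [SetLike.mem_coe, LinearMap.mem_ker, LinearMap.comp_apply, AlgHom.toLinearMap_apply,
    polyRescale_partialMonomial, LinearMap.rTensor_tmul, this, TensorProduct.zero_tmul]

/-- The rescaling of the fields on integrals. -/
def integralRescale (z : Fin 3 → Couplings) : Integrals →ₗ[ℂ] Integrals ⊗[ℂ] Couplings :=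
  totalDerivatives.liftQ
    (totalDerivatives.mkQ.rTensor Couplings ∘ₗ (polyRescale z).toLinearMap)
    (totalDerivatives_le_ker_rescale z)

theorem integralRescale_integral (z : Fin 3 → Couplings) (w : List JetVar) :
    integralRescale z (integral w) = integral w ⊗ₜ wordFactor z w := by
  rw [integral, integralRescale, Submodule.mkQ_apply, Submodule.liftQ_apply,
    LinearMap.comp_apply, AlgHom.toLinearMap_apply, polyRescale_monomial,
    LinearMap.rTensor_tmul, Submodule.mkQ_apply]

/-- The inclusion of the integrals in the algebra of local functionals. -/
def integralIncl : Integrals →ₗ[ℂ] Loc :=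
  (RingQuot.mkAlgHom ℂ LocRel).toLinearMap ∘ₗ TensorAlgebra.ι ℂ

theorem integralIncl_integral (w : List JetVar) : integralIncl (integral w) = locIntegral w :=
  rfl

theorem locIntegral_mul_comm (v w : List JetVar) : locIntegral v * locIntegral w =
    koszul (wordDegree v) (wordDegree w) • (locIntegral w * locIntegral v) := by
  simpa only [locIntegral, map_mul, map_smul] using RingQuot.mkAlgHom_rel ℂ (LocRel.swap v w)

/-- The rescaling of the fields on local functionals. -/
def locRescale (z : Fin 3 → Couplings) : Loc →ₐ[ℂ] F :=
  RingQuot.liftAlgHom ℂ ⟨TensorAlgebra.lift ℂ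
    (integralIncl.rTensor Couplings ∘ₗ integralRescale z), by
    rintro _ _ ⟨v, w⟩
    simp only [map_mul, map_smul, TensorAlgebra.lift_ι_apply, LinearMap.comp_apply,
      integralRescale_integral, LinearMap.rTensor_tmul, integralIncl_integral,
      Algebra.TensorProduct.tmul_mul_tmul, locIntegral_mul_comm v w, TensorProduct.smul_tmul',
      mul_comm (wordFactor z v)]⟩

theorem locRescale_locIntegral (z : Fin 3 → Couplings) (w : List JetVar) :
    locRescale z (locIntegral w) = locIntegral w ⊗ₜ wordFactor z w := by
  rw [locRescale, locIntegral, RingQuot.liftAlgHom_mkAlgHom_apply, TensorAlgebra.lift_ι_apply,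
    LinearMap.comp_apply, integralRescale_integral, LinearMap.rTensor_tmul,
    integralIncl_integral, locIntegral]

/-- Composition with a formal diffeomorphism as an algebra map. -/
def Diff.pullHom (D : Diff) : Couplings →ₐ[ℂ] Couplings :=
  MvPowerSeries.substAlgHom D.hasSubst

theorem Diff.pullHom_apply (D : Diff) (a : Couplings) : D.pullHom a = D.pull a :=
  MvPowerSeries.substAlgHom_apply D.hasSubst a

/-- `F` is only graded commutative, but its second tensor factor is commutative and hence central.
-/
theorem commute_ofSeries (x : F) (a : Couplings) : Commute x (ofSeries a) := by
  induction x using TensorProduct.induction_on with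
  | zero => exact Commute.zero_left _
  | add x y hx hy => exact hx.add_left hy
  | tmul _ b =>
    simp only [Commute, SemiconjBy, ofSeries, Algebra.TensorProduct.tmul_mul_tmul, one_mul,
      mul_one, mul_comm a]

theorem commute_locRescale (D : Diff) (z : Fin 3 → Couplings) : ∀ x a,
    letI : Mul F := Distrib.toMul
    Commute (locRescale z x)
      (((Algebra.TensorProduct.includeRight : Couplings →ₐ[ℂ] F).comp D.pullHom) a) :=
  fun _ a => commute_ofSeries _ (D.pullHom a)

/-- The algebra map that rescales the couplings by the coefficients of `D` and the fields
by `z`. -/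
def rescale (D : Diff) (z : Fin 3 → Couplings) : F →ₐ[ℂ] F :=
  Algebra.TensorProduct.lift (locRescale z)
    ((Algebra.TensorProduct.includeRight : Couplings →ₐ[ℂ] F).comp D.pullHom)
    (commute_locRescale D z)

theorem rescale_ofSeries (D : Diff) (z : Fin 3 → Couplings) (a : Couplings) :
    rescale D z (ofSeries a) = ofSeries (D.pull a) := by
  simp [rescale, ofSeries, Diff.pullHom_apply]

theorem rescalesBy_rescale (D : Diff) (z : Fin 3 → Couplings) :
    RescalesBy (rescale D z) D.coef z where
  coupling j := by rw [QCD.coupling, rescale_ofSeries, Diff.pull_X, Diff.map]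
  integral w := by
    rw [rescale, Algebra.TensorProduct.lift_tmul, locRescale_locIntegral, map_one, mul_one,
      wordFactor]

/-! ### Uniqueness -/

theorem monomial_append (v w : List JetVar) : monomial (v ++ w) = monomial v * monomial w := by
  simp [monomial]

theorem span_range_monomial : Submodule.span ℂ (Set.range monomial) = ⊤ := by
  rw [eq_top_iff]
  rintro x -
  obtain ⟨x, rfl⟩ := RingQuot.mkAlgHom_surjective ℂ JetRel x
  induction x using FreeAlgebra.induction with
  | grade0 r =>
    rw [AlgHom.commutes, Algebra.algebraMap_eq_smul_one]
    exact Submodule.smul_mem _ _ (Submodule.subset_span ⟨[], rfl⟩)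
  | grade1 x => exact Submodule.subset_span ⟨[x], by simp [monomial, jet]⟩
  | mul x y hx hy =>
    rw [map_mul]
    have := Submodule.mul_mem_mul hx hy
    rw [Submodule.span_mul_span] at this
    refine Submodule.span_mono ?_ this
    rintro _ ⟨_, ⟨v, rfl⟩, _, ⟨w, rfl⟩, rfl⟩
    exact ⟨v ++ w, monomial_append v w⟩
  | add x y hx hy =>
    rw [map_add]
    exact Submodule.add_mem _ hx hy

theorem integrals_linearMap_ext {M : Type*} [AddCommMonoid M] [Module ℂ M]
    {f g : Integrals →ₗ[ℂ] M} (h : ∀ w, f (integral w) = g (integral w)) : f = g := by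
  have : f ∘ₗ totalDerivatives.mkQ = g ∘ₗ totalDerivatives.mkQ := by
    refine LinearMap.ext_on span_range_monomial ?_
    rintro _ ⟨w, rfl⟩
    exact h w
  refine LinearMap.ext fun x => ?_
  obtain ⟨x, rfl⟩ := totalDerivatives.mkQ_surjective x
  exact LinearMap.congr_fun this x

theorem loc_algHom_ext {B : Type*} [Semiring B] [Algebra ℂ B] {f g : Loc →ₐ[ℂ] B}
    (h : ∀ w, f (locIntegral w) = g (locIntegral w)) : f = g := by
  refine RingQuot.ringQuot_ext' _ _ _ (TensorAlgebra.hom_ext ?_)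
  exact integrals_linearMap_ext h

namespace RescalesBy

variable {f g : F →ₐ[ℂ] F} {c c' : Fin 5 → Couplings} {z z' : Fin 3 → Couplings}

/-- A rescaling map is determined by the factors. -/
theorem algHom_ext (hf : RescalesBy f c z) (hg : RescalesBy g c z) : f = g := by
  apply Algebra.TensorProduct.ext
  · refine loc_algHom_ext fun w => ?_
    exact (hf.integral w).trans (hg.integral w).symm
  · exact series_algHom_ext c hf.coupling hg.coupling

/-- The factors are determined by the rescaling map. -/
theorem unique (h : RescalesBy f c z) (h' : RescalesBy f c' z') : c = c' ∧ z = z' := by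
  have hfield : ∀ x : JetVar, x.deriv = 0 → factor z x.field = factor z' x.field := by
    intro x hx
    apply tmul_injective (exists_functional_integral x hx)
    simpa using (h.integral [x]).symm.trans (h'.integral [x])
  constructor
  · funext j
    have := ofSeries_injective ((h.coupling j).symm.trans (h'.coupling j))
    ext n
    -- Shifting the exponent by one cancels the variable `X j`.
    have := congrArg (MvPowerSeries.coeff (Finsupp.single j 1 + n)) this
    simpa [MvPowerSeries.X, MvPowerSeries.coeff_add_monomial_mul] using this
  · funext i
    match i with
    | 0 => exact hfield ⟨.psi, ((0 : Fin 4), (0 : Fin 3)), 0⟩ rfl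
    | 1 => exact hfield ⟨.omega, (0 : Fin 8), 0⟩ rfl
    | 2 => exact hfield ⟨.A, ((0 : Fin 4), (0 : Fin 8)), 0⟩ rfl

end RescalesBy

theorem wordFactor_mul_pull (D : Diff) (z z' : Fin 3 → Couplings) (w : List JetVar) :
    wordFactor z w * D.pull (wordFactor z' w) =
      wordFactor (fun i => z i * D.pull (z' i)) w := by
  have hone : D.pull 1 = 1 := by rw [← D.pullHom_apply, map_one]
  induction w with
  | nil => simp [wordFactor, hone]
  | cons x w ih =>
    have hx : factor z x.field * D.pull (factor z' x.field) =
        factor (fun i => z i * D.pull (z' i)) x.field := by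
      cases x.field <;> simp [factor, hone]
    simp only [wordFactor, List.map_cons, List.prod_cons] at ih ⊢
    rw [← ih, ← hx, Diff.pull_mul]
    ring

/-- The outer map also substitutes `D` into the series `z'` produced by the inner one, and
substitution is contravariant in the diffeomorphism. -/
theorem rescale_comp (D D' : Diff) (z z' : Fin 3 → Couplings) :
    (rescale D z).comp (rescale D' z') =
      rescale (D' * D) (fun i => z i * D.pull (z' i)) := by
  refine RescalesBy.algHom_ext ⟨fun j => ?_, fun w => ?_⟩ (rescalesBy_rescale _ _)
  · rw [AlgHom.comp_apply, coupling, rescale_ofSeries, rescale_ofSeries, Diff.pull_pull,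
      Diff.pull_X, Diff.map]
  · have h : ∀ (x : Loc) (a : Couplings), (x ⊗ₜ[ℂ] a : F) = x ⊗ₜ 1 * ofSeries a := by
      simp [ofSeries]
    have h' := (rescalesBy_rescale D z).integral w
    change _ = _ ⊗ₜ wordFactor _ w at h'
    rw [AlgHom.comp_apply, (rescalesBy_rescale D' z').integral, h, map_mul, rescale_ofSeries,
      h', ofSeries, Algebra.TensorProduct.tmul_mul_tmul, mul_one]
    exact congrArg _ (wordFactor_mul_pull D z z' w)

theorem rescale_one : rescale 1 1 = AlgHom.id ℂ F := by
  refine RescalesBy.algHom_ext (rescalesBy_rescale _ _) ⟨fun j => ?_, fun w => ?_⟩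
  · exact congrArg ofSeries (mul_one _).symm
  · have : ∀ t, factor 1 t = 1 := fun t => by cases t <;> rfl
    simp [this]

/-! ### The group of rescaling maps -/

theorem Diff.pull_one_right (D : Diff) : D.pull 1 = 1 := by
  rw [← D.pullHom_apply, map_one]

theorem constantCoeff_oneUnits (u : OneUnits) :
    MvPowerSeries.constantCoeff ((u : Couplingsˣ) : Couplings) = 1 :=
  congrArg Units.val (MonoidHom.mem_ker.mp u.2)

/-- A power series with constant term `1` as an element of the group of such series. -/
def oneUnit (a : Couplings) (ha : MvPowerSeries.constantCoeff a = 1) : OneUnits :=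
  ⟨⟨a, a⁻¹, MvPowerSeries.mul_inv_cancel _ (by simp [ha]),
    MvPowerSeries.inv_mul_cancel _ (by simp [ha])⟩, MonoidHom.mem_ker.mpr (Units.ext ha)⟩

theorem oneUnits_ext {u v : OneUnits}
    (h : ((u : Couplingsˣ) : Couplings) = ((v : Couplingsˣ) : Couplings)) : u = v :=
  Subtype.ext (Units.ext h)

/-- The action of formal diffeomorphisms on power series with constant term `1`. -/
def pullUnits (D : Diff) : OneUnits →* OneUnits where
  toFun u := oneUnit (D.pull ((u : Couplingsˣ) : Couplings)) (by
    rw [Diff.constantCoeff_pull, constantCoeff_oneUnits])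
  map_one' := oneUnits_ext D.pull_one_right
  map_mul' u v := oneUnits_ext (D.pull_mul _ _)

/-- The action of formal diffeomorphisms on `U³`. -/
def diffAct : Diff →* MulAut (Fin 3 → OneUnits) where
  toFun D :=
    -- The inverse turns the right action by substitution into a left action.
    { toFun z i := pullUnits D⁻¹ (z i)
      invFun z i := pullUnits D (z i)
      left_inv z := funext fun i => oneUnits_ext <| by
        change D.pull (D⁻¹.pull _) = _
        rw [Diff.pull_pull, inv_mul_cancel, Diff.pull_one]
      right_inv z := funext fun i => oneUnits_ext <| by
        change D⁻¹.pull (D.pull _) = _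
        rw [Diff.pull_pull, mul_inv_cancel, Diff.pull_one]
      map_mul' z z' := funext fun i => map_mul _ _ _ }
  map_one' := MulEquiv.ext fun z => funext fun i => oneUnits_ext <| by
    change (1⁻¹ : Diff).pull _ = _
    rw [inv_one, Diff.pull_one]
    rfl
  map_mul' D D' := MulEquiv.ext fun z => funext fun i => oneUnits_ext <| by
    change (D * D')⁻¹.pull _ = D⁻¹.pull (D'⁻¹.pull _)
    rw [Diff.pull_pull, mul_inv_rev]

/-- The underlying power series of an element of `U³`. -/
def toSeries (z : Fin 3 → OneUnits) (i : Fin 3) : Couplings := ((z i : Couplingsˣ) : Couplings)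

theorem toSeries_injective : Function.Injective toSeries := fun _ _ h =>
  funext fun i => oneUnits_ext (congrFun h i)

/-- The semidirect product `U³ ⋊ Diff(ℂ⁵, 0)`. -/
abbrev RescaleGroup : Type := (Fin 3 → OneUnits) ⋊[diffAct] Diff

/-- The semidirect product acts on `F` by algebra endomorphisms. -/
def rescaleEnd : RescaleGroup →* (F →ₐ[ℂ] F) where
  toFun g := rescale g.right⁻¹ (toSeries g.left)
  map_one' := by
    rw [SemidirectProduct.one_right, inv_one]
    exact rescale_one
  map_mul' g g' := by
    refine Eq.trans ?_ (rescale_comp _ _ _ _).symm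
    rw [SemidirectProduct.mul_right, mul_inv_rev]
    rfl

/-- The semidirect product acts on `F` by algebra automorphisms. -/
def rescaleAut : RescaleGroup →* (F ≃ₐ[ℂ] F) :=
  -- A monoid homomorphism out of a group takes values in units, so invertibility is automatic.
  (AlgEquiv.algHomUnitsEquiv ℂ F).toMonoidHom.comp rescaleEnd.toHomUnits

theorem rescalesBy_rescaleAut (g : RescaleGroup) :
    RescalesBy (rescaleAut g : F →ₐ[ℂ] F) g.right⁻¹.coef (toSeries g.left) :=
  rescalesBy_rescale _ _

theorem rescaleAut_injective : Function.Injective rescaleAut := fun g g' h => by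
  obtain ⟨hc, hz⟩ := (rescalesBy_rescaleAut g).unique (h ▸ rescalesBy_rescaleAut g')
  exact SemidirectProduct.ext (toSeries_injective hz) (inv_injective (Diff.ext hc))

/-- The group of rescaling automorphisms is the semidirect product. -/
def rescaleEquiv : rescaleAut.range ≃* RescaleGroup :=
  (MonoidHom.ofInjective rescaleAut_injective).symm

theorem rescaleAut_rescaleEquiv (g : rescaleAut.range) :
    rescaleAut (rescaleEquiv g) = (g : F ≃ₐ[ℂ] F) :=
  congrArg Subtype.val ((MonoidHom.ofInjective rescaleAut_injective).apply_symm_apply g)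

theorem rescalesBy_rescaleEquiv (g : rescaleAut.range) :
    RescalesBy ((g : F ≃ₐ[ℂ] F) : F →ₐ[ℂ] F) (rescaleEquiv g).right⁻¹.coef
      (toSeries (rescaleEquiv g).left) := by
  have := rescalesBy_rescaleAut (rescaleEquiv g)
  rwa [rescaleAut_rescaleEquiv] at this

/-- The element of the semidirect product that rescales the generators by `c` and `z`. -/
def ofFactors (c : Fin 5 → Couplings) (z : Fin 3 → Couplings)
    (hc : ∀ j, MvPowerSeries.constantCoeff (c j) = 1)
    (hz : ∀ i, MvPowerSeries.constantCoeff (z i) = 1) : RescaleGroup :=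
  ⟨fun i => oneUnit (z i) (hz i), (⟨c, hc⟩ : Diff)⁻¹⟩

theorem rescalesBy_ofFactors (c : Fin 5 → Couplings) (z : Fin 3 → Couplings)
    (hc : ∀ j, MvPowerSeries.constantCoeff (c j) = 1)
    (hz : ∀ i, MvPowerSeries.constantCoeff (z i) = 1) :
    RescalesBy (rescaleAut (ofFactors c z hc hz) : F →ₐ[ℂ] F) c z := by
  have := rescalesBy_rescaleAut (ofFactors c z hc hz)
  rwa [ofFactors, inv_inv] at this

/-- By uniqueness, any rescaling coincides with the constructed map having the same factors, and is
therefore invertible. -/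
theorem isRescaling_iff (f : F →ₐ[ℂ] F) :
    IsRescaling f ↔ ∃ g ∈ rescaleAut.range, (g : F →ₐ[ℂ] F) = f := by
  constructor
  · rintro ⟨c, z, hc, hz, h⟩
    exact ⟨_, ⟨ofFactors c z hc hz, rfl⟩, (rescalesBy_ofFactors c z hc hz).algHom_ext h⟩
  · rintro ⟨_, ⟨g, rfl⟩, rfl⟩
    exact ⟨_, _, Diff.constantCoeff_coef _, fun i => constantCoeff_oneUnits _,
      rescalesBy_rescaleAut g⟩

/-! ### The subgroup fixing the couplings -/

/-- The rescaling automorphisms that fix the coupling constants. -/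
def fixCouplings : Subgroup rescaleAut.range :=
  (SemidirectProduct.rightHom.comp rescaleEquiv.toMonoidHom).ker

theorem mem_fixCouplings {g : rescaleAut.range} :
    g ∈ fixCouplings ↔ (rescaleEquiv g).right = 1 := Iff.rfl

theorem mem_fixCouplings_iff (g : rescaleAut.range) :
    g ∈ fixCouplings ↔ ∀ j, (g : F ≃ₐ[ℂ] F) (coupling j) = coupling j := by
  have h := rescalesBy_rescaleEquiv g
  rw [mem_fixCouplings]
  constructor
  · intro h1 j
    rw [h1, inv_one] at h
    refine (h.coupling j).trans ?_
    exact congrArg ofSeries (mul_one _)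
  · intro hj
    have h' : RescalesBy ((g : F ≃ₐ[ℂ] F) : F →ₐ[ℂ] F) 1 (toSeries (rescaleEquiv g).left) :=
      ⟨fun j => (hj j).trans (congrArg ofSeries (mul_one _).symm), h.integral⟩
    exact inv_eq_one.mp (Diff.ext (h.unique h').1)

/-- The rescaling automorphisms that fix the coupling constants form the group `U³`. -/
def fixCouplingsEquiv : fixCouplings ≃* (Fin 3 → OneUnits) where
  toFun g := (rescaleEquiv g).left
  invFun z := ⟨rescaleEquiv.symm (SemidirectProduct.inl z), by
    simp [mem_fixCouplings]⟩
  left_inv g := by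
    refine Subtype.ext (rescaleEquiv.injective ?_)
    rw [MulEquiv.apply_symm_apply]
    exact SemidirectProduct.ext rfl (mem_fixCouplings.mp g.2).symm
  right_inv z := by simp
  map_mul' g g' := by
    -- With trivial diffeomorphism part, the twist in the semidirect product disappears.
    have hg : (rescaleEquiv g).right = 1 := mem_fixCouplings.mp g.2
    simp [hg]

theorem rescalesBy_fixCouplingsEquiv (g : fixCouplings) :
    RescalesBy (((g : rescaleAut.range) : F ≃ₐ[ℂ] F) : F →ₐ[ℂ] F) 1
      (toSeries (fixCouplingsEquiv g)) := by
  have h := rescalesBy_rescaleEquiv g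
  rwa [mem_fixCouplings.mp g.2, inv_one] at h

/-! ### Characters of Hopf algebras generated by Green's functions -/

/-- Expands `b · (a ∘ D)` as the sum of `a_n x^n · b · ∏ D.coef k ^ n k`, in the shape of the
Green's function coproduct. -/
theorem Diff.coeff_mul_pull (D : Diff) (b a : Couplings) (m : Fin 5 →₀ ℕ) :
    MvPowerSeries.coeff m (b * D.pull a) =
      ∑ p ∈ Finset.HasAntidiagonal.antidiagonal m,
        MvPowerSeries.coeff p.1 (b * ∏ k, D.coef k ^ p.2 k) * MvPowerSeries.coeff p.2 a := by
  classical
  -- Only exponents `d ≤ j` contribute; indexing by the antidiagonal of `m` makes the range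
  -- independent of `j`, so the sums can be interchanged.
  have hpull : ∀ j ≤ m, MvPowerSeries.coeff j (D.pull a) =
      ∑ p ∈ Finset.HasAntidiagonal.antidiagonal m, MvPowerSeries.coeff p.2 a *
        MvPowerSeries.coeff j
          (MvPowerSeries.monomial p.2 (1 : ℂ) * ∏ i, D.coef i ^ p.2 i) := by
    intro j hj
    rw [Diff.pull, MvPowerSeries.coeff_subst D.hasSubst, finsum_eq_sum_of_support_subset
      (s := (Finset.HasAntidiagonal.antidiagonal m).image Prod.snd), Finset.sum_image]
    · simp only [Diff.prod_map, smul_eq_mul]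
    · intro p hp q hq hpq
      refine Prod.ext ?_ hpq
      have hp := Finset.HasAntidiagonal.mem_antidiagonal.mp hp
      have hq := Finset.HasAntidiagonal.mem_antidiagonal.mp hq
      rw [← hq, hpq] at hp
      exact add_right_cancel hp
    · intro d hd
      by_contra hdm
      refine hd ?_
      change _ • _ = _
      rw [Diff.prod_map, MvPowerSeries.coeff_monomial_mul, if_neg, smul_zero]
      intro hdj
      refine hdm (Finset.mem_image.mpr ⟨(m - d, d), ?_, rfl⟩)
      exact Finset.HasAntidiagonal.mem_antidiagonal.mpr (tsub_add_cancel_of_le (hdj.trans hj))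
  have hmul : ∀ p ∈ Finset.HasAntidiagonal.antidiagonal m,
      MvPowerSeries.coeff p.1 (b * ∏ k, D.coef k ^ p.2 k) = MvPowerSeries.coeff m
        (b * (MvPowerSeries.monomial p.2 (1 : ℂ) * ∏ i, D.coef i ^ p.2 i)) := by
    intro p hp
    rw [← Finset.HasAntidiagonal.mem_antidiagonal.mp hp, add_comm, mul_left_comm,
      MvPowerSeries.coeff_add_monomial_mul, one_mul]
  rw [MvPowerSeries.coeff_mul, Finset.sum_congr rfl fun q hq => by
    rw [hpull q.2 (Finset.HasAntidiagonal.mem_antidiagonal.mp hq ▸ le_add_self),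
      Finset.mul_sum], Finset.sum_comm]
  refine Finset.sum_congr rfl fun p hp => ?_
  rw [hmul p hp, MvPowerSeries.coeff_mul, Finset.sum_mul]
  exact Finset.sum_congr rfl fun q _ => by ring

section Characters

variable {H : Type*} [CommRing H] [HopfAlgebra ℂ H]

theorem charSeries_eq_map (χ : CharacterGroup H) (a : (Fin 5 →₀ ℕ) → H) :
    charSeries χ a = MvPowerSeries.map (χ.ofConv : H →+* ℂ) (genSeries a) := rfl

theorem character_tmul (χ χ' : CharacterGroup H) (h : H) :
    (χ * χ').ofConv h = Algebra.TensorProduct.lmul' ℂ (S := ℂ)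
      (Algebra.TensorProduct.map χ.ofConv χ'.ofConv (Coalgebra.comul (R := ℂ) h)) := rfl

/-- Applying `χ ⊗ χ'` to the coproduct gives the expansion in `Diff.coeff_mul_pull`, since `χ` acts
coefficientwise and respects products of series. -/
theorem charSeries_mul (χ χ' : CharacterGroup H) (D : Diff)
    (Y : Fin 5 → (Fin 5 →₀ ℕ) → H) (hD : ∀ k, D.coef k = charSeries χ (Y k))
    (a : (Fin 5 →₀ ℕ) → H)
    (ha : ∀ m, Coalgebra.comul (R := ℂ) (a m) =
      ∑ p ∈ Finset.HasAntidiagonal.antidiagonal m,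
        MvPowerSeries.coeff p.1 (genSeries a * ∏ k, genSeries (Y k) ^ p.2 k) ⊗ₜ[ℂ] a p.2) :
    charSeries (χ * χ') a = charSeries χ a * D.pull (charSeries χ' a) := by
  ext m
  rw [Diff.coeff_mul_pull]
  change (χ * χ').ofConv (a m) = _
  rw [character_tmul, ha]
  simp only [map_sum, Algebra.TensorProduct.map_tmul, Algebra.TensorProduct.lmul'_apply_tmul]
  refine Finset.sum_congr rfl fun p _ => ?_
  congr 1
  simp only [hD, charSeries_eq_map, ← map_pow, ← map_prod, ← map_mul, MvPowerSeries.coeff_map]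
  rfl

variable {Y : Fin 5 → (Fin 5 →₀ ℕ) → H} {E : Fin 3 → (Fin 5 →₀ ℕ) → H}

theorem constantCoeff_charSeries (χ : CharacterGroup H) {a : (Fin 5 →₀ ℕ) → H}
    (ha : a 0 = 1) : MvPowerSeries.constantCoeff (charSeries χ a) = 1 := by
  change χ.ofConv (a 0) = 1
  rw [ha, map_one]

/-- The rescaling automorphism defined by a character. -/
def characterAut (h : IsGreenHopfAlgebra H Y E) (χ : CharacterGroup H) : RescaleGroup :=
  ofFactors (fun j => charSeries χ (Y j)) (fun i => charSeries χ (E i))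
    (fun j => constantCoeff_charSeries χ (h.Y_zero j))
    (fun i => constantCoeff_charSeries χ (h.E_zero i))

theorem rescalesBy_characterAut (h : IsGreenHopfAlgebra H Y E) (χ : CharacterGroup H) :
    RescalesBy (rescaleAut (characterAut h χ) : F →ₐ[ℂ] F)
      (fun j => charSeries χ (Y j)) (fun i => charSeries χ (E i)) :=
  rescalesBy_ofFactors _ _ _ _

theorem characterAut_mul (h : IsGreenHopfAlgebra H Y E) (χ χ' : CharacterGroup H) :
    characterAut h (χ * χ') = characterAut h χ * characterAut h χ' := by
  let D : CharacterGroup H → Diff := fun χ =>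
    ⟨fun j => charSeries χ (Y j), fun j => constantCoeff_charSeries χ (h.Y_zero j)⟩
  -- The order is reversed because `f * g` has coefficients `g.coef j * g.pull (f.coef j)`; the
  -- inverse in `ofFactors` restores it.
  have key : D (χ * χ') = D χ' * D χ := Diff.ext <| funext fun j =>
    charSeries_mul χ χ' (D χ) Y (fun _ => rfl) (Y j) (h.comul_Y j)
  refine SemidirectProduct.ext (funext fun i => oneUnits_ext ?_) ?_
  · have := charSeries_mul χ χ' (D χ) Y (fun _ => rfl) (E i) (h.comul_E i)
    refine this.trans ?_
    change _ = charSeries χ (E i) * (D χ)⁻¹⁻¹.pull (charSeries χ' (E i))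
    rw [inv_inv]
  · change (D (χ * χ'))⁻¹ = (D χ)⁻¹ * (D χ')⁻¹
    rw [key, mul_inv_rev]

/-- The character group as a group of rescaling automorphisms. -/
def characterHom (h : IsGreenHopfAlgebra H Y E) : CharacterGroup H →* rescaleAut.range :=
  rescaleAut.rangeRestrict.comp (MonoidHom.mk' (characterAut h) (characterAut_mul h))

theorem characterHom_injective (h : IsGreenHopfAlgebra H Y E) :
    Function.Injective (characterHom h) := by
  intro χ χ' hχ
  have h1 := rescalesBy_characterAut h χ
  have e : rescaleAut (characterAut h χ) = rescaleAut (characterAut h χ') :=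
    congrArg Subtype.val hχ
  rw [e] at h1
  obtain ⟨hY, hE⟩ := h1.unique (rescalesBy_characterAut h χ')
  have : χ.ofConv = χ'.ofConv := by
    refine AlgHom.ext_of_adjoin_eq_top h.adjoin_eq_top ?_
    rintro _ (⟨p, rfl⟩ | ⟨p, rfl⟩)
    · exact congrFun (congrFun hY p.1) p.2
    · exact congrFun (congrFun hE p.1) p.2
  exact WithConv.ofConv_injective this

end Characters

end QCD

end

theorem mainTheorem4 :
    ∃ G' : Subgroup (QCD.F ≃ₐ[ℂ] QCD.F),
      (∀ f : QCD.F →ₐ[ℂ] QCD.F,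
        QCD.IsRescaling f ↔ ∃ g ∈ G', (g : QCD.F →ₐ[ℂ] QCD.F) = f) ∧
      (∀ (H : Type*) [CommRing H] [HopfAlgebra ℂ H]
        (Y : Fin 5 → (Fin 5 →₀ ℕ) → H) (E : Fin 3 → (Fin 5 →₀ ℕ) → H),
        QCD.IsGreenHopfAlgebra H Y E →
        ∃ ι : QCD.CharacterGroup H →* G', Function.Injective ι ∧
          ∀ χ, QCD.RescalesBy ((ι χ : QCD.F ≃ₐ[ℂ] QCD.F) : QCD.F →ₐ[ℂ] QCD.F)
            (fun j => QCD.charSeries χ (Y j)) (fun i => QCD.charSeries χ (E i))) ∧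
      (∃ N : Subgroup G',
        (∀ g : G', g ∈ N ↔ ∀ j, (g : QCD.F ≃ₐ[ℂ] QCD.F) (QCD.coupling j) = QCD.coupling j) ∧
        N.Normal ∧
        ∃ e : N ≃* (Fin 3 → QCD.OneUnits), ∀ g : N,
          QCD.RescalesBy (((g : G') : QCD.F ≃ₐ[ℂ] QCD.F) : QCD.F →ₐ[ℂ] QCD.F)
            1 (fun i => ((e g i : QCD.Couplingsˣ) : QCD.Couplings))) ∧
      (∃ act : QCD.Diff →* MulAut (Fin 3 → QCD.OneUnits),
        (∀ (F : QCD.Diff) (z : Fin 3 → QCD.OneUnits) (i : Fin 3),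
          ((act F z i : QCD.Couplingsˣ) : QCD.Couplings) =
            F⁻¹.pull ((z i : QCD.Couplingsˣ) : QCD.Couplings)) ∧
        ∃ e : G' ≃* (Fin 3 → QCD.OneUnits) ⋊[act] QCD.Diff, ∀ g : G',
          QCD.RescalesBy ((g : QCD.F ≃ₐ[ℂ] QCD.F) : QCD.F →ₐ[ℂ] QCD.F)
            ((e g).right⁻¹).coef
            (fun i => (((e g).left i : QCD.Couplingsˣ) : QCD.Couplings))) := by
  refine ⟨QCD.rescaleAut.range, QCD.isRescaling_iff, ?_, ?_, ?_⟩
  · intro H _ _ Y E h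
    exact ⟨QCD.characterHom h, QCD.characterHom_injective h, QCD.rescalesBy_characterAut h⟩
  · exact ⟨QCD.fixCouplings, QCD.mem_fixCouplings_iff, MonoidHom.normal_ker _,
      QCD.fixCouplingsEquiv, QCD.rescalesBy_fixCouplingsEquiv⟩
  · exact ⟨QCD.diffAct, fun _ _ _ => rfl, QCD.rescaleEquiv, QCD.rescalesBy_rescaleEquiv⟩
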